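/- For graphs $G$, $H$ and an integer $q$ with $2\le q\le |E(H)|$, an $(H,q)$-coloring of $G$ is a (not necessarily proper) edge-coloring of $G$ in which every copy of $H$ in $G$ (every subgraph of $G$ isomorphic to $H$) receives at least $q$ distinct colors, and $r(G,H,q)$ denotes the minimum number of colors needed for $G$ to have an $(H,q)$-coloring. Let $K_{n,n}$ denote the complete bipartite graph with both parts of size $n$. **Theorem.** For every integer $p\ge 2$, $$r\left(K_{n,n},K_{p,p},p^2-p+1\right)=\Omega\left(n^{2-\frac{2}{\lfloor p/2\rfloor}}\right)\qquad (n\to\infty),$$ that is, there exist a constant $c>0$ and an integer $N$, both depending only on $p$, such that $r(K_{n,n},K_{p,p},p^2-p+1)\ge c\,n^{2-2/\lfloor p/2\rfloor}$ for all $n\ge N$. -/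

import Mathlib

/-- An `(H, q)`-coloring of `G` with colors from `Fin k`: a (not necessarily proper) edge-coloring
of `G` such that every copy of `H` in `G`, i.e. every subgraph of `G` isomorphic to `H`,
receives at least `q` distinct colors. -/
def IsErdosGyarfasColoring {V W : Type*} (G : SimpleGraph V) (H : SimpleGraph W) (q : ℕ) {k : ℕ}
    (c : G.edgeSet → Fin k) : Prop :=
  ∀ K : G.Subgraph, Nonempty (H ≃g K.coe) →
    q ≤ (c '' {e : G.edgeSet | (e : Sym2 V) ∈ K.edgeSet}).ncard

/-- `r(G, H, q)`: the minimum number of colors needed for `G` to have an `(H, q)`-coloring. -/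
noncomputable def erdosGyarfasNumber {V W : Type*} (G : SimpleGraph V) (H : SimpleGraph W)
    (q : ℕ) : ℕ :=
  sInf {k : ℕ | ∃ c : G.edgeSet → Fin k, IsErdosGyarfasColoring G H q c}

/-- For finite `G` and `q ≤ |E(H)|` the minimum is over a nonempty set, hence attained. -/
theorem exists_isErdosGyarfasColoring {V W : Type*} [Finite V] (G : SimpleGraph V)
    (H : SimpleGraph W) (q : ℕ) (hq : q ≤ H.edgeSet.ncard) :
    ∃ c : G.edgeSet → Fin (erdosGyarfasNumber G H q), IsErdosGyarfasColoring G H q c := by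
  have key : {k : ℕ | ∃ c : G.edgeSet → Fin k, IsErdosGyarfasColoring G H q c}.Nonempty := by
    refine ⟨Nat.card G.edgeSet, Finite.equivFin G.edgeSet, ?_⟩
    rintro K ⟨f⟩
    rw [Set.ncard_image_of_injective _ (Finite.equivFin G.edgeSet).injective]
    refine hq.trans ?_
    let g : Sym2 W → Sym2 V := Sym2.map fun w => (f w : V)
    have hg : Function.Injective g :=
      Sym2.map.injective (Subtype.val_injective.comp f.injective)
    have hK : ∀ e ∈ H.edgeSet, g e ∈ K.edgeSet := by
      intro e
      induction e using Sym2.ind with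
      | _ a b =>
        intro h
        exact f.map_rel_iff.2 h
    rw [← Set.ncard_image_of_injective {e : G.edgeSet | (e : Sym2 V) ∈ K.edgeSet}
      Subtype.val_injective]
    refine Set.ncard_le_ncard_of_injOn g ?_ hg.injOn (Set.toFinite _)
    intro e he
    exact ⟨⟨g e, K.edgeSet_subset (hK e he)⟩, hK e he, rfl⟩
  exact Nat.sInf_mem key

/-!
A `p × p` rectangle of the edge set `A × B` of `K_{n,n}` may have at most `p - 1` repetitions of
colors, where the number of repetitions in a set of edges is its size minus its number of colors.
Put `t = ⌊p / 2⌋` and suppose that there are far fewer than `n ^ (2 - 2 / t)` colors.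

*Repetitions.* If `s ≤ p` vertices on each side span `s` repetitions, involving a color that occurs
more than `p ^ 2` times, then edges of this color can be added one at a time; each needs at most one
new vertex per side and is one more repetition, so a forbidden rectangle results
(`false_of_card_image_add_le`).

*A properly colored part.* Few edges have a color occurring at most `p ^ 2` times. For the others,
a `2 × 2` rectangle with two colors would already be forbidden, so a pair of vertices is the pair of
ends of at most one monochromatic path with two edges, and most edges meet only boundedly many edges
of their own color. Hence a constant proportion `I` of all edges is properly colored
(`exists_properly_colored_subset`).

*The color energy graph.* Join `(a, a') ∈ A × A` to `(b, b') ∈ B × B` if `ab` and `a'b'` are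
distinct edges in `I` of the same color. By Cauchy–Schwarz this graph has of order `n ^ 4 / k`
edges, where `k` is the number of colors (`card_sq_le_card_mul_colorEnergy`). It has `2 * n ^ 2`
vertices, so if `k` is small its average degree exceeds a large multiple of `n ^ (2 / t)`, and the
Moore bound yields a cycle of length at most `2 * t` (`exists_short_bipartite_cycle`).

*Degenerate cycles are harmless.* Let `F` be the set of edges `ab`, `a'b'` coming from the edges of
this cycle. The vertices of the cycle may share coordinates, but every color in `F` occurs at least
twice, so `F` has at least `#F / 2` repetitions; and as `I` is properly colored, every vertex has
degree at least two in `F`, so `F` meets at most `#F / 2` vertices of each side, and at most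
`2 * t ≤ p` of them (`exists_card_image_add_le_of_cycle`). This contradicts the first point.
-/

/-! ### Short cycles in dense graphs -/

section ShortCycles

variable {V : Type*} {G : SimpleGraph V}

/-- Two distinct vertices at the same distance `r` from a root are joined by a path of length at
most `2 * r` inside the ball of radius `r` that avoids the edge between them, if any: follow the
two geodesics towards the root until they meet. -/
theorem SimpleGraph.exists_isPath_of_edist_eq {v₀ : V} (r : ℕ) {u₁ u₂ : V} (hne : u₁ ≠ u₂)
    (h₁ : G.edist v₀ u₁ = r) (h₂ : G.edist v₀ u₂ = r) :
    ∃ q : G.Walk u₁ u₂, q.IsPath ∧ q.length ≤ 2 * r ∧ s(u₂, u₁) ∉ q.edges ∧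
      ∀ x ∈ q.support, G.edist v₀ x ≤ r := by
  induction r generalizing u₁ u₂ with
  | zero =>
    simp only [Nat.cast_zero, SimpleGraph.edist_eq_zero_iff] at h₁ h₂
    exact absurd (h₁.symm.trans h₂) hne
  | succ r ih =>
    have par : ∀ u : V, G.edist v₀ u = ((r + 1 : ℕ) : ℕ∞) →
        ∃ p : V, G.Adj p u ∧ G.edist v₀ p = r := by
      intro u hu
      obtain ⟨w, hw⟩ := SimpleGraph.exists_walk_of_edist_eq_coe hu
      have hnil : ¬ w.Nil := by
        intro h
        have := SimpleGraph.Walk.length_eq_zero_iff.2 h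
        omega
      refine ⟨w.penultimate, w.adj_penultimate hnil, le_antisymm ?_ ?_⟩
      · refine (SimpleGraph.edist_le w.dropLast).trans ?_
        have : w.dropLast.length = r := by simp [hw]
        rw [this]
      · have h := G.edist_triangle (u := v₀) (v := w.penultimate) (w := u)
        rw [hu, SimpleGraph.edist_eq_one_iff_adj.2 (w.adj_penultimate hnil)] at h
        push_cast at h
        exact (ENat.add_le_add_iff_right (by simp)).1 h
    obtain ⟨p₁, ha₁, hp₁⟩ := par u₁ h₁
    obtain ⟨p₂, ha₂, hp₂⟩ := par u₂ h₂
    have hlt : ((r : ℕ) : ℕ∞) < ((r + 1 : ℕ) : ℕ∞) := by exact_mod_cast Nat.lt_succ_self r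
    obtain ⟨q, hq, hlen, hsup⟩ : ∃ q : G.Walk p₁ p₂, q.IsPath ∧ q.length ≤ 2 * r ∧
        ∀ x ∈ q.support, G.edist v₀ x ≤ r := by
      by_cases hp : p₁ = p₂
      · subst hp
        exact ⟨.nil, by simp, by simp, by simp [hp₁]⟩
      · obtain ⟨q, hq, hlen, -, hsup⟩ := ih hp hp₁ hp₂
        exact ⟨q, hq, hlen, hsup⟩
    have n₁ : u₁ ∉ q.support := fun h => by
      have := hsup _ h
      rw [h₁] at this
      exact absurd this (not_le.2 hlt)
    have n₂ : u₂ ∉ q.support := fun h => by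
      have := hsup _ h
      rw [h₂] at this
      exact absurd this (not_le.2 hlt)
    refine ⟨.cons ha₁.symm (q.concat ha₂), ?_, ?_, ?_, ?_⟩
    · rw [SimpleGraph.Walk.cons_isPath_iff]
      refine ⟨hq.concat n₂ ha₂, ?_⟩
      rw [SimpleGraph.Walk.support_concat]
      simp [n₁, hne]
    · simp
      omega
    · rw [SimpleGraph.Walk.edges_cons, SimpleGraph.Walk.edges_concat]
      simp only [List.concat_eq_append, List.mem_append, List.mem_cons, List.not_mem_nil,
        or_false, not_or]
      refine ⟨fun h => ?_, fun h => n₂ (q.fst_mem_support_of_mem_edges h), fun h => ?_⟩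
      · rw [Sym2.eq_swap, Sym2.congr_right] at h
        exact n₂ (h ▸ q.start_mem_support)
      · rw [Sym2.eq_swap, Sym2.congr_left] at h
        exact n₁ (h ▸ q.end_mem_support)
    · intro x hx
      simp only [SimpleGraph.Walk.support_cons, SimpleGraph.Walk.support_concat,
        List.mem_cons, List.mem_append, List.not_mem_nil, or_false] at hx
      rcases hx with rfl | hx | rfl
      · exact h₁.le
      · exact (hsup x hx).trans hlt.le
      · exact h₂.le

/-- The Moore bound: if all degrees exceed `d` and every cycle is longer than `2 * t`, then each
of the first `t` distance layers around a vertex is at least `d` times as large as the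
preceding one. -/
theorem SimpleGraph.pow_le_card_of_lt_degree_of_lt_length_isCycle [Fintype V] [Nonempty V]
    [DecidableRel G.Adj] {d t : ℕ} (hd : ∀ v, d < G.degree v)
    (hcyc : ∀ (v : V) (c : G.Walk v v), c.IsCycle → 2 * t < c.length) :
    d ^ t ≤ Fintype.card V := by
  classical
  obtain ⟨v₀⟩ := ‹Nonempty V›
  let L : ℕ → Finset V := fun i => {v | G.edist v₀ v = i}
  have memL : ∀ i v, v ∈ L i ↔ G.edist v₀ v = i := fun i v => by simp [L]
  -- Two neighbors of `w` lying on one layer below `t` close up to a cycle of length `≤ 2 * t`.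
  have uniq : ∀ i < t, ∀ w, w ∈ L (i + 1) → ∀ u₁ ∈ L i, ∀ u₂ ∈ L i, G.Adj u₁ w → G.Adj u₂ w →
      u₁ = u₂ := by
    intro i hi w hw u₁ h₁ u₂ h₂ a₁ a₂
    by_contra hne
    rw [memL] at hw h₁ h₂
    obtain ⟨q, hq, hlen, -, hsup⟩ := SimpleGraph.exists_isPath_of_edist_eq i hne h₁ h₂
    have hw' : w ∉ q.support := fun h => by
      have := hsup _ h
      rw [hw] at this
      have h2 : i + 1 ≤ i := by exact_mod_cast this
      omega
    have hc : (SimpleGraph.Walk.cons a₁.symm (q.concat a₂)).IsCycle := by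
      rw [SimpleGraph.Walk.cons_isCycle_iff]
      refine ⟨hq.concat hw' a₂, ?_⟩
      rw [SimpleGraph.Walk.edges_concat]
      simp only [List.concat_eq_append, List.mem_append, List.mem_singleton, not_or]
      refine ⟨fun h => hw' (q.fst_mem_support_of_mem_edges h), fun h => hne ?_⟩
      rw [Sym2.eq_swap] at h
      exact (Sym2.congr_left.1 h)
    have := hcyc _ _ hc
    simp only [SimpleGraph.Walk.length_cons, SimpleGraph.Walk.length_concat] at this
    omega
  have indep : ∀ i < t, ∀ u₁ ∈ L i, ∀ u₂ ∈ L i, ¬ G.Adj u₁ u₂ := by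
    intro i hi u₁ h₁ u₂ h₂ a
    rw [memL] at h₁ h₂
    obtain ⟨q, hq, hlen, he, -⟩ := SimpleGraph.exists_isPath_of_edist_eq i a.ne h₁ h₂
    have := hcyc _ _ ((SimpleGraph.Walk.cons_isCycle_iff q a.symm).2 ⟨hq, he⟩)
    simp only [SimpleGraph.Walk.length_cons] at this
    omega
  have step : ∀ i < t, d * (L i).card ≤ (L (i + 1)).card := by
    intro i hi
    have key := Finset.card_mul_le_card_mul (s := L i) (t := L (i + 1)) (m := d) (n := 1) G.Adj
      ?_ ?_
    · linarith
    · intro v hv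
      let low : Finset V := {u ∈ G.neighborFinset v | G.edist v₀ u + 1 = i}
      have hlow : low.card ≤ 1 := by
        rw [Finset.card_le_one]
        intro a ha b hb
        simp only [low, Finset.mem_filter, SimpleGraph.mem_neighborFinset] at ha hb
        rcases i with _ | j
        · exact absurd ha.2 (by simp)
        · have e : ∀ x : ℕ∞, x + 1 = ((j + 1 : ℕ) : ℕ∞) → x = j := by
            intro x hx
            induction x using ENat.recTopCoe with
            | top =>
              rw [top_add] at hx
              exact absurd hx.symm (ENat.natCast_ne_top _)
            | coe m =>
              norm_cast at hx ⊢
              omega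
          exact uniq j (by omega) v hv a ((memL _ _).2 (e _ ha.2)) b ((memL _ _).2 (e _ hb.2))
            ha.1.symm hb.1.symm
      have hsub : G.neighborFinset v ⊆ Finset.bipartiteAbove G.Adj (L (i + 1)) v ∪ low := by
        intro u hu
        have hu' : G.Adj v u := by simpa using hu
        have hv' := (memL _ _).1 hv
        have t₁ : G.edist v₀ u ≤ i + 1 := by
          have := G.edist_triangle (u := v₀) (v := v) (w := u)
          rwa [hv', SimpleGraph.edist_eq_one_iff_adj.2 hu'] at this
        have t₂ : (i : ℕ∞) ≤ G.edist v₀ u + 1 := by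
          have := G.edist_triangle (u := v₀) (v := u) (w := v)
          rwa [hv', SimpleGraph.edist_eq_one_iff_adj.2 hu'.symm] at this
        have t₃ : G.edist v₀ u ≠ i := fun h => indep i hi v hv u ((memL _ _).2 h) hu'
        obtain ⟨m, hm⟩ := ENat.ne_top_iff_exists.1 (ne_top_of_le_ne_top (by simp) t₁)
        rw [← hm] at t₁ t₂ t₃
        norm_cast at t₁ t₂ t₃
        simp only [Finset.mem_union, Finset.mem_bipartiteAbove, memL, low, Finset.mem_filter, ← hm]
        norm_cast
        rcases (by omega : m = i + 1 ∨ m + 1 = i) with h | h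
        · exact Or.inl ⟨h, hu'⟩
        · exact Or.inr ⟨hu, h⟩
      have c₁ := (Finset.card_le_card hsub).trans (Finset.card_union_le _ _)
      have c₂ := hd v
      rw [SimpleGraph.card_neighborFinset_eq_degree] at c₁
      omega
    · intro w hw
      rw [Finset.card_le_one]
      intro a ha b hb
      rw [Finset.mem_bipartiteBelow] at ha hb
      exact uniq i hi w hw a ha.1 b hb.1 ha.2 hb.2
  have grow : ∀ i ≤ t, d ^ i ≤ (L i).card := by
    intro i
    induction i with
    | zero =>
      intro _
      exact Finset.card_pos.2 ⟨v₀, by simp [L]⟩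
    | succ i ih =>
      intro hi
      calc d ^ (i + 1) = d * d ^ i := by ring
        _ ≤ d * (L i).card := Nat.mul_le_mul_left _ (ih (by omega))
        _ ≤ _ := step i (by omega)
  exact (grow t le_rfl).trans (Finset.card_le_univ _)

/-- A graph spanning more than `d` edges per vertex on `W` (edges counted twice below) has a
subgraph of minimum degree exceeding `d`: delete vertices of small degree one by one. -/
theorem SimpleGraph.exists_subset_lt_card_filter_adj [DecidableEq V] [DecidableRel G.Adj] (d : ℕ)
    (W : Finset V)
    (hW : 2 * d * W.card < ∑ v ∈ W, (W.filter (G.Adj v)).card) :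
    ∃ U ⊆ W, U.Nonempty ∧ ∀ v ∈ U, d < (U.filter (G.Adj v)).card := by
  induction W using Finset.strongInduction with
  | H W ih =>
    by_cases h : ∀ v ∈ W, d < (W.filter (G.Adj v)).card
    · refine ⟨W, subset_rfl, ?_, h⟩
      rw [Finset.nonempty_iff_ne_empty]
      rintro rfl
      simp at hW
    · push Not at h
      obtain ⟨w, hw, hdeg⟩ := h
      obtain ⟨U, hU, hU'⟩ := ih (W.erase w) (Finset.erase_ssubset hw) (by
        have hc := Finset.card_erase_add_one hw
        have hs := Finset.add_sum_erase W (fun v => (W.filter (G.Adj v)).card) hw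
        have hle : ∑ v ∈ W.erase w, (W.filter (G.Adj v)).card ≤
            ∑ v ∈ W.erase w,
              (((W.erase w).filter (G.Adj v)).card + if G.Adj w v then 1 else 0) := by
          refine Finset.sum_le_sum fun v _ => ?_
          rw [Finset.filter_erase]
          split_ifs with hvw
          · have := Finset.pred_card_le_card_erase (s := W.filter (G.Adj v)) (a := w)
            omega
          · rw [Finset.erase_eq_of_notMem (by simp [hvw, G.adj_comm v w])]
            omega
        rw [Finset.sum_add_distrib, ← Finset.card_filter] at hle
        have hle2 : ((W.erase w).filter (G.Adj w)).card ≤ (W.filter (G.Adj w)).card :=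
          Finset.card_le_card (Finset.filter_subset_filter _ (Finset.erase_subset _ _))
        rw [← hc] at hW
        nlinarith)
      exact ⟨U, hU.trans (Finset.erase_subset _ _), hU'⟩

/-- In a `2`-colored graph a walk of length `ℓ` visits either color every other step. -/
theorem SimpleGraph.Walk.two_mul_countP_support (f : V → Bool)
    (hf : ∀ u v, G.Adj u v → f u ≠ f v) {u v : V} (w : G.Walk u v) :
    2 * w.support.countP f = w.length + (f u).toNat + (f v).toNat := by
  induction w with
  | nil => rename_i u; cases h : f u <;> simp [h]
  | @cons u x v h w ih =>
    have := hf _ _ h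
    rw [SimpleGraph.Walk.support_cons, List.countP_cons, mul_add, ih,
      SimpleGraph.Walk.length_cons]
    cases h1 : f u <;> cases h2 : f x <;> simp_all
    omega

/-- A cycle in a `2`-colored graph has equally many vertices of both colors. -/
theorem SimpleGraph.Walk.IsCycle.two_mul_card_filter_support [DecidableEq V] (f : V → Bool)
    (hf : ∀ u v, G.Adj u v → f u ≠ f v) {u : V} {c : G.Walk u u} (hc : c.IsCycle) :
    2 * (c.support.toFinset.filter (f ·)).card = c.length := by
  have h := SimpleGraph.Walk.two_mul_countP_support f hf c
  have e : c.support.toFinset = c.support.tail.toFinset := by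
    ext x
    simp only [List.mem_toFinset]
    refine ⟨fun hx => ?_, List.mem_of_mem_tail⟩
    rw [SimpleGraph.Walk.mem_support_iff] at hx
    rcases hx with rfl | hx
    · exact SimpleGraph.Walk.end_mem_tail_support hc.not_nil
    · exact hx
  have e2 : (c.support.tail.toFinset.filter (f ·)).card = c.support.tail.countP f := by
    rw [List.countP_eq_length_filter, ← List.toFinset_filter]
    exact List.toFinset_card_of_nodup (hc.support_nodup.filter _)
  rw [e, e2]
  rw [← c.cons_tail_support, List.countP_cons] at h
  cases h1 : f u <;> simp [h1] at h <;> omega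

/-- Every vertex of a cycle has two distinct neighbors on it. -/
theorem SimpleGraph.Walk.IsCycle.exists_adj_adj {u : V} {c : G.Walk u u} (hc : c.IsCycle)
    {v : V} (hv : v ∈ c.support) :
    ∃ x ∈ c.support, ∃ y ∈ c.support, x ≠ y ∧ G.Adj v x ∧ G.Adj v y := by
  have h := hc.ncard_neighborSet_toSubgraph_eq_two hv
  obtain ⟨x, y, hxy, he⟩ := Set.ncard_eq_two.1 h
  have hx : c.toSubgraph.Adj v x := by
    have : x ∈ c.toSubgraph.neighborSet v := by rw [he]; simp
    exact this
  have hy : c.toSubgraph.Adj v y := by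
    have : y ∈ c.toSubgraph.neighborSet v := by rw [he]; simp
    exact this
  exact ⟨x, by simpa using hx.snd_mem, y, by simpa using hy.snd_mem, hxy, hx.adj_sub, hy.adj_sub⟩

/-- The bipartite graph of a relation. -/
def SimpleGraph.ofBipartiteRel {X Y : Type*} (R : X → Y → Prop) : SimpleGraph (X ⊕ Y) where
  Adj
    | .inl x, .inr y => R x y
    | .inr y, .inl x => R x y
    | _, _ => False
  symm := ⟨by rintro (x | x) (y | y) h <;> exact h⟩
  loopless := ⟨by rintro (x | x) h <;> exact h⟩

/-- A bipartite graph with many edges contains a cycle of length at most `2 * t`; `C` and `D` are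
the vertices of this cycle on the two sides. -/
theorem exists_short_bipartite_cycle {X Y : Type*} [Fintype X] [Fintype Y] (R : X → Y → Prop)
    [DecidablePred fun z : X × Y => R z.1 z.2] {d t : ℕ}
    (hd : Fintype.card X + Fintype.card Y < d ^ t)
    (hR : d * (Fintype.card X + Fintype.card Y) < (Finset.univ.filter
      fun z : X × Y => R z.1 z.2).card) :
    ∃ (C : Finset X) (D : Finset Y), C.Nonempty ∧ C.card ≤ t ∧ D.card ≤ t ∧
      (∀ x ∈ C, ∃ y ∈ D, ∃ y' ∈ D, y ≠ y' ∧ R x y ∧ R x y') ∧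
      (∀ y ∈ D, ∃ x ∈ C, ∃ x' ∈ C, x ≠ x' ∧ R x y ∧ R x' y) := by
  classical
  let G := SimpleGraph.ofBipartiteRel R
  obtain ⟨U, -, hU, hdeg⟩ := G.exists_subset_lt_card_filter_adj d Finset.univ (by
    have e₁ : ∀ x : X, (Finset.univ.filter (G.Adj (.inl x))).card =
        ∑ y : Y, if R x y then 1 else 0 := by
      intro x
      rw [Finset.card_filter, Fintype.sum_sum_type]
      simp [G, SimpleGraph.ofBipartiteRel]
    have e₂ : ∀ y : Y, (Finset.univ.filter (G.Adj (.inr y))).card =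
        ∑ x : X, if R x y then 1 else 0 := by
      intro x
      rw [Finset.card_filter, Fintype.sum_sum_type]
      simp [G, SimpleGraph.ofBipartiteRel]
    rw [Finset.card_filter, ← Finset.univ_product_univ, Finset.sum_product] at hR
    rw [Fintype.sum_sum_type]
    simp only [e₁, e₂]
    rw [Finset.sum_comm (s := (Finset.univ : Finset Y)), Finset.card_univ, Fintype.card_sum]
    simp only at hR
    linarith)
  let H := G.induce (U : Set (X ⊕ Y))
  obtain ⟨v, c, hc, hlen⟩ : ∃ (v : (U : Set (X ⊕ Y))) (c : H.Walk v v),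
      c.IsCycle ∧ c.length ≤ 2 * t := by
    by_contra! hcon
    have : Nonempty (U : Set (X ⊕ Y)) := hU.to_subtype
    refine absurd (H.pow_le_card_of_lt_degree_of_lt_length_isCycle (d := d) (t := t) ?_ hcon) ?_
    · intro v
      refine (hdeg v v.2).trans_le ?_
      rw [← SimpleGraph.card_neighborFinset_eq_degree,
        ← Finset.card_map (Function.Embedding.subtype _)]
      refine Finset.card_le_card fun x hx => ?_
      rw [Finset.mem_filter] at hx
      exact Finset.mem_map.2 ⟨⟨x, hx.1⟩, by simpa [H] using hx.2, rfl⟩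
    · rw [not_le]
      refine lt_of_le_of_lt ?_ hd
      rw [← Fintype.card_sum]
      exact Fintype.card_subtype_le _
  replace hc : (c.map (SimpleGraph.Embedding.induce (G := G) (U : Set (X ⊕ Y))).toHom).IsCycle :=
    hc.map Subtype.val_injective
  obtain ⟨v, c, hc, hlen⟩ : ∃ (v : X ⊕ Y) (c : G.Walk v v), c.IsCycle ∧ c.length ≤ 2 * t :=
    ⟨_, _, hc, (SimpleGraph.Walk.length_map _ _).trans_le hlen⟩
  have hl := hc.two_mul_card_filter_support Sum.isLeft
    (by rintro (x | x) (y | y) h <;> simp_all [G, SimpleGraph.ofBipartiteRel])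
  have hr := hc.two_mul_card_filter_support Sum.isRight
    (by rintro (x | x) (y | y) h <;> simp_all [G, SimpleGraph.ofBipartiteRel])
  have h3 := hc.three_le_length
  have cardL : c.support.toFinset.toLeft.card =
      (c.support.toFinset.filter (Sum.isLeft ·)).card := by
    rw [← Finset.card_map Function.Embedding.inl]
    congr 1
    ext (x | x) <;> simp
  have cardR : c.support.toFinset.toRight.card =
      (c.support.toFinset.filter (Sum.isRight ·)).card := by
    rw [← Finset.card_map Function.Embedding.inr]
    congr 1
    ext (x | x) <;> simp
  refine ⟨c.support.toFinset.toLeft, c.support.toFinset.toRight, ?_, ?_, ?_, ?_, ?_⟩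
  · rw [← Finset.card_pos]
    omega
  · omega
  · omega
  · intro x hx
    simp only [Finset.mem_toLeft, List.mem_toFinset] at hx
    obtain ⟨a | a, ha, b | b, hb, hab, h₁, h₂⟩ := hc.exists_adj_adj hx
    · exact h₁.elim
    · exact h₁.elim
    · exact h₂.elim
    · exact ⟨a, by simpa using ha, b, by simpa using hb, fun h => hab (h ▸ rfl), h₁, h₂⟩
  · intro x hx
    simp only [Finset.mem_toRight, List.mem_toFinset] at hx
    obtain ⟨a | a, ha, b | b, hb, hab, h₁, h₂⟩ := hc.exists_adj_adj hx
    · exact ⟨a, by simpa using ha, b, by simpa using hb, fun h => hab (h ▸ rfl), h₁, h₂⟩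
    · exact h₂.elim
    · exact h₁.elim
    · exact h₁.elim

end ShortCycles

/-! ### Repetitions of colors in small subgraphs -/

section Repetitions

open Finset

variable {α β κ : Type*} [DecidableEq α] [DecidableEq β] [DecidableEq κ]

/-- If every `p × p` rectangle carries more than `p ^ 2 - p` colors, then no set `F` of edges on
at most `s ≤ p` vertices per side has `s` repetitions of colors, provided some color of `F` is
frequent: edges of this color can be added one at a time, each one costing at most one vertex per
side and adding one repetition, until there are `p` repetitions. -/
theorem false_of_card_image_add_le [Fintype α] [Fintype β] {c : α × β → κ} {p : ℕ}
    (hc : ∀ (S : Finset α) (T : Finset β), #S = p → #T = p → p ^ 2 - p < #((S ×ˢ T).image c))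
    (hα : p ≤ Fintype.card α) (hβ : p ≤ Fintype.card β) {s : ℕ} (hs : s ≤ p)
    {S : Finset α} {T : Finset β} {F : Finset (α × β)} (hF : F ⊆ S ×ˢ T)
    (hS : #S ≤ s) (hT : #T ≤ s) (hrep : #(F.image c) + s ≤ #F) {e₀ : α × β} (he₀ : e₀ ∈ F)
    (hbig : p ^ 2 < #{e | c e = c e₀}) : False := by
  induction hk : p - s generalizing s S T F with
  | zero =>
    obtain rfl : s = p := by omega
    obtain ⟨S', hSS', hS'⟩ := Finset.exists_superset_card_eq hS hα
    obtain ⟨T', hTT', hT'⟩ := Finset.exists_superset_card_eq hT hβ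
    have hF' : F ⊆ S' ×ˢ T' := hF.trans (product_subset_product hSS' hTT')
    have h₁ := hc S' T' hS' hT'
    have h₂ : #((S' ×ˢ T').image c) ≤ #(F.image c) + #((S' ×ˢ T') \ F) := by
      conv_lhs => rw [← union_sdiff_of_subset hF', image_union]
      exact (card_union_le _ _).trans (Nat.add_le_add_left card_image_le _)
    have h₃ := card_sdiff_add_card_eq_card hF'
    rw [card_product, hS', hT', ← pow_two] at h₃
    omega
  | succ k ih =>
    have hFs : #F ≤ p ^ 2 := by
      refine (card_le_card hF).trans ?_
      rw [card_product, pow_two]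
      exact Nat.mul_le_mul (hS.trans hs) (hT.trans hs)
    obtain ⟨e, he, heF⟩ := exists_mem_notMem_of_card_lt_card (hFs.trans_lt hbig)
    rw [mem_filter] at he
    refine ih (s := s + 1) (S := insert e.1 S) (T := insert e.2 T) (F := insert e F) (by omega)
      ?_ ((card_insert_le _ _).trans (by omega)) ((card_insert_le _ _).trans (by omega)) ?_
      (mem_insert_of_mem he₀) (by omega)
    · intro x hx
      rw [mem_insert] at hx
      rw [mem_product]
      rcases hx with rfl | hx
      · exact ⟨mem_insert_self _ _, mem_insert_self _ _⟩
      · exact ⟨mem_insert_of_mem (mem_product.1 (hF hx)).1,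
          mem_insert_of_mem (mem_product.1 (hF hx)).2⟩
    · rw [image_insert, he.2, insert_eq_of_mem (mem_image_of_mem c he₀), card_insert_of_notMem heF]
      omega

/-! ### Passing to a properly colored set of edges -/

/-- If no two monochromatic pairs of edges at distinct `f`-ends have the same pair of `g`-ends,
then few edges have many edges of their own color at their `f`-end. -/
theorem mul_card_filter_le_card_add_sq {ι α β κ : Type*} [DecidableEq ι] [DecidableEq α]
    [DecidableEq κ] [Fintype β] (E : Finset ι) (f : ι → α)
    (g : ι → β) (c : ι → κ) (hinj : ∀ e e', f e = f e' → g e = g e' → e = e')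
    (hch : ∀ e ∈ E, ∀ e' ∈ E, ∀ h ∈ E, ∀ h' ∈ E, e ≠ e' → f e = f e' → c e = c e' →
      f h = f h' → c h = c h' → g e = g h → g e' = g h' → e = h) (D : ℕ) :
    D * #{e ∈ E | D ≤ #{e' ∈ E | f e' = f e ∧ c e' = c e}} ≤ #E + Fintype.card β ^ 2 := by
  let P : Finset (ι × ι) := {z ∈ E ×ˢ E | f z.2 = f z.1 ∧ c z.2 = c z.1}
  have memP : ∀ z, z ∈ P ↔ (z.1 ∈ E ∧ z.2 ∈ E) ∧ f z.2 = f z.1 ∧ c z.2 = c z.1 := by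
    intro z
    simp only [P, mem_filter, mem_product]
  have h₁ : D * #{e ∈ E | D ≤ #{e' ∈ E | f e' = f e ∧ c e' = c e}} ≤ #P := by
    calc _ = ∑ _e ∈ E with D ≤ #{e' ∈ E | f e' = f _e ∧ c e' = c _e}, D := by
          simp [mul_comm]
      _ ≤ ∑ e ∈ E with D ≤ #{e' ∈ E | f e' = f e ∧ c e' = c e},
            #{e' ∈ E | f e' = f e ∧ c e' = c e} :=
          sum_le_sum fun e he => (mem_filter.1 he).2
      _ ≤ ∑ e ∈ E, #{e' ∈ E | f e' = f e ∧ c e' = c e} :=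
          sum_le_sum_of_subset (filter_subset _ _)
      _ = #P := by
          simp only [P]
          simp_rw [card_filter]
          rw [sum_product]
  have h₂ : #{z ∈ P | z.1 = z.2} ≤ #E := by
    refine card_le_card_of_injOn Prod.fst (fun z hz => ?_) fun z hz w hw h => ?_
    · simp only [coe_filter, Set.mem_ofPred_eq, memP] at hz
      exact hz.1.1.1
    · simp only [coe_filter, Set.mem_ofPred_eq] at hz hw
      exact Prod.ext h (hz.2.symm.trans (h.trans hw.2))
  have h₃ : #{z ∈ P | ¬ z.1 = z.2} ≤ Fintype.card β ^ 2 := by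
    rw [pow_two, ← Fintype.card_prod, ← card_univ]
    refine card_le_card_of_injOn (fun z => (g z.1, g z.2)) (by simp) fun z hz w hw h => ?_
    simp only [coe_filter, Set.mem_ofPred_eq, memP] at hz hw
    obtain ⟨⟨⟨a₁, a₂⟩, a₃, a₄⟩, a₅⟩ := hz
    obtain ⟨⟨⟨b₁, b₂⟩, b₃, b₄⟩, b₅⟩ := hw
    have g₁ : g z.1 = g w.1 := congrArg Prod.fst h
    have g₂ : g z.2 = g w.2 := congrArg Prod.snd h
    have e := hch _ a₁ _ a₂ _ b₁ _ b₂ a₅ a₃.symm a₄.symm b₃.symm b₄.symm g₁ g₂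
    exact Prod.ext e (hinj _ _ (by rw [a₃, b₃, e]) g₂)
  have h₄ := card_filter_add_card_filter_not (s := P) (fun z => z.1 = z.2)
  omega

/-- Keeping one edge for each pair of an `f`-end and a color. -/
theorem exists_subset_injOn_card_le {ι α κ : Type*} [DecidableEq ι] [DecidableEq α]
    [DecidableEq κ] (E : Finset ι) (f : ι → α) (c : ι → κ) (m : ℕ)
    (h : ∀ e ∈ E, #{e' ∈ E | f e' = f e ∧ c e' = c e} ≤ m) :
    ∃ I ⊆ E, #E ≤ m * #I ∧ ∀ e ∈ I, ∀ e' ∈ I, f e = f e' → c e = c e' → e = e' := by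
  obtain ⟨I, hI, hinj, him⟩ := exists_subset_injOn_image_eq_of_surjOn E
    (E.image fun e => (f e, c e)) (f := fun e => (f e, c e)) (by
      rw [coe_image]
      exact Set.surjOn_image _ _)
  refine ⟨I, hI, ?_, fun e he e' he' h₁ h₂ => hinj he he' (Prod.ext h₁ h₂)⟩
  have := card_le_mul_card_image (f := fun e => (f e, c e)) E m (by
    intro b hb
    obtain ⟨e, he, rfl⟩ := mem_image.1 hb
    simpa using h e he)
  rwa [← him, card_image_of_injOn hinj] at this

/-- A constant proportion of the edges is properly colored, by frequent colors. -/
theorem exists_properly_colored_subset [Fintype α] [Fintype β] [Fintype κ] {c : α × β → κ}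
    {p n : ℕ}
    (hc : ∀ (S : Finset α) (T : Finset β), #S = p → #T = p → p ^ 2 - p < #((S ×ˢ T).image c))
    (hp : 2 ≤ p) (hα : Fintype.card α = n) (hβ : Fintype.card β = n) (hn : p ≤ n)
    (hκ : 9 * (Fintype.card κ * p ^ 2) ≤ n ^ 2) :
    ∃ I : Finset (α × β), n ^ 2 ≤ 144 * #I ∧ (∀ e ∈ I, p ^ 2 < #{e' | c e' = c e}) ∧
      (∀ e ∈ I, ∀ e' ∈ I, e.1 = e'.1 → c e = c e' → e = e') ∧
      (∀ e ∈ I, ∀ e' ∈ I, e.2 = e'.2 → c e = c e' → e = e') := by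
  let E : Finset (α × β) := {e | p ^ 2 < #{e' | c e' = c e}}
  have hE : n ^ 2 ≤ #E + Fintype.card κ * p ^ 2 := by
    have h₁ := card_filter_add_card_filter_not (s := (univ : Finset (α × β)))
      (fun e => p ^ 2 < #{e' | c e' = c e})
    rw [card_univ, Fintype.card_prod, hα, hβ, ← pow_two] at h₁
    have h₂ := card_le_mul_card_image_of_maps_to (f := c) (t := univ)
      (s := ({e | ¬ p ^ 2 < #{e' | c e' = c e}} : Finset (α × β))) (by simp) (p ^ 2) (by
        intro k _
        by_contra! hk
        obtain ⟨e, he⟩ := card_pos.1 (Nat.zero_lt_of_lt hk)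
        simp only [mem_filter, mem_univ, true_and] at he
        refine not_lt.2 he.1 (hk.trans_le (card_le_card fun x hx => ?_))
        simp only [mem_filter, mem_univ, true_and] at hx ⊢
        rw [hx.2, he.2])
    rw [card_univ, mul_comm] at h₂
    simp only [E]
    omega
  have hEn : #E ≤ n ^ 2 := by
    refine (card_le_univ _).trans ?_
    rw [Fintype.card_prod, hα, hβ, ← pow_two]
  have memE : ∀ e, e ∈ E ↔ p ^ 2 < #{e' | c e' = c e} := fun e => by simp [E]
  -- A `2 × 2` rectangle with a frequent color has at least three colors.
  have square : ∀ x y b b', x ≠ y → b ≠ b' → (x, b) ∈ E →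
      #((({x, y} : Finset α) ×ˢ ({b, b'} : Finset β)).image c) ≤ 2 → False := by
    intro x y b b' hxy hb he h2
    refine false_of_card_image_add_le hc (hα ▸ hn) (hβ ▸ hn) hp (S := {x, y}) (T := {b, b'})
      subset_rfl (card_le_two) (card_le_two) ?_ (e₀ := (x, b)) (by simp) ((memE _).1 he)
    rw [card_product, card_pair hxy, card_pair hb]
    omega
  have hA := mul_card_filter_le_card_add_sq E Prod.fst Prod.snd c (fun e e' => Prod.ext) (by
    rintro ⟨x, b⟩ he ⟨x', b'⟩ he' ⟨y, d⟩ hh ⟨y', d'⟩ hh' hne h₁ h₂ h₃ h₄ h₅ h₆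
    simp only at h₁ h₃ h₅ h₆
    subst h₁ h₃ h₅ h₆
    by_contra hxy
    refine square x y b b' (fun h => hxy (by rw [h])) (fun h => hne (by rw [h])) he ?_
    refine (card_le_card (t := {c (x, b), c (y, b)}) ?_).trans card_le_two
    intro k hk
    simp only [mem_image, mem_product, mem_insert, mem_singleton, Prod.exists] at hk ⊢
    obtain ⟨a, d, ⟨rfl | rfl, rfl | rfl⟩, rfl⟩ := hk <;> simp [h₂, h₄]) 9
  have hB := mul_card_filter_le_card_add_sq E Prod.snd Prod.fst c
    (fun e e' h₁ h₂ => Prod.ext h₂ h₁) (by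
    rintro ⟨b, x⟩ he ⟨b', x'⟩ he' ⟨d, y⟩ hh ⟨d', y'⟩ hh' hne h₁ h₂ h₃ h₄ h₅ h₆
    simp only at h₁ h₃ h₅ h₆
    subst h₁ h₃ h₅ h₆
    by_contra hxy
    refine square b b' x y (fun h => hne (by rw [h])) (fun h => hxy (by rw [h])) he ?_
    refine (card_le_card (t := {c (b, x), c (b, y)}) ?_).trans card_le_two
    intro k hk
    simp only [mem_image, mem_product, mem_insert, mem_singleton, Prod.exists] at hk ⊢
    obtain ⟨a, d, ⟨rfl | rfl, rfl | rfl⟩, rfl⟩ := hk <;> simp [h₂, h₄]) 9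
  rw [hβ] at hA
  rw [hα] at hB
  -- With threshold 9, each of `A` and `B` has at most `2 * n ^ 2 / 9` edges. As `E` has at least
  -- `8 * n ^ 2 / 9`, half of these remain, and at least one in `8 * 8` of the rest is kept.
  let A : Finset (α × β) := {e ∈ E | 9 ≤ #{e' ∈ E | e'.1 = e.1 ∧ c e' = c e}}
  let B : Finset (α × β) := {e ∈ E | 9 ≤ #{e' ∈ E | e'.2 = e.2 ∧ c e' = c e}}
  have hAB : #E ≤ #(E \ (A ∪ B)) + #A + #B := by
    have h₁ := card_sdiff_add_card (s := E) (t := A ∪ B)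
    have h₂ := card_le_card (subset_union_left (s₁ := E) (s₂ := A ∪ B))
    have h₃ := card_union_le A B
    omega
  obtain ⟨I₁, hI₁, hc₁, hinj₁⟩ := exists_subset_injOn_card_le (E \ (A ∪ B)) Prod.fst c 8 (by
    intro e he
    rw [mem_sdiff, mem_union, not_or] at he
    have h₁ : #{e' ∈ E | e'.1 = e.1 ∧ c e' = c e} < 9 := by
      by_contra! h
      exact he.2.1 (mem_filter.2 ⟨he.1, h⟩)
    exact (card_le_card (filter_subset_filter _ sdiff_subset)).trans (Nat.le_of_lt_succ h₁))
  obtain ⟨I, hI, hc₂, hinj₂⟩ := exists_subset_injOn_card_le I₁ Prod.snd c 8 (by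
    intro e he
    have he' := hI₁ he
    rw [mem_sdiff, mem_union, not_or] at he'
    have h₁ : #{e' ∈ E | e'.2 = e.2 ∧ c e' = c e} < 9 := by
      by_contra! h
      exact he'.2.2 (mem_filter.2 ⟨he'.1, h⟩)
    exact (card_le_card (filter_subset_filter _ (hI₁.trans sdiff_subset))).trans
      (Nat.le_of_lt_succ h₁))
  refine ⟨I, ?_, fun e he => (memE e).1 (mem_sdiff.1 (hI₁ (hI he))).1,
    fun e he e' he' => hinj₁ e (hI he) e' (hI he'), hinj₂⟩
  change 9 * #A ≤ _ at hA
  change 9 * #B ≤ _ at hB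
  omega

/-! ### The color energy graph -/

/-- The relation underlying the color energy graph of a set `I` of colored edges: the pair
`(a, a')` is joined to `(b, b')` if `ab` and `a'b'` are distinct edges in `I` of one color. -/
def ColorEnergyRel (I : Finset (α × β)) (c : α × β → κ) (z : α × α) (w : β × β) : Prop :=
  (z.1, w.1) ∈ I ∧ (z.2, w.2) ∈ I ∧ (z.1, w.1) ≠ (z.2, w.2) ∧ c (z.1, w.1) = c (z.2, w.2)

instance (I : Finset (α × β)) (c : α × β → κ) :
    DecidablePred fun z : (α × α) × (β × β) => ColorEnergyRel I c z.1 z.2 := fun _ =>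
  inferInstanceAs (Decidable (_ ∧ _))

/-- By the Cauchy–Schwarz inequality, few colors force many edges of the color energy graph. -/
theorem card_sq_le_card_mul_colorEnergy [Fintype α] [Fintype β] [Fintype κ]
    (I : Finset (α × β)) (c : α × β → κ) :
    #I ^ 2 ≤ Fintype.card κ *
      (#{z : (α × α) × (β × β) | ColorEnergyRel I c z.1 z.2} + #I) := by
  let P : Finset ((α × β) × (α × β)) := {z ∈ I ×ˢ I | c z.1 = c z.2}
  have memP : ∀ z, z ∈ P ↔ (z.1 ∈ I ∧ z.2 ∈ I) ∧ c z.1 = c z.2 := by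
    intro z
    simp only [P, mem_filter, mem_product]
  have h₁ : #I ^ 2 ≤ Fintype.card κ * #P := by
    have hI : #I = ∑ k : κ, #{e ∈ I | c e = k} :=
      card_eq_sum_card_fiberwise (by simp)
    have hP : #P = ∑ k : κ, #{e ∈ I | c e = k} ^ 2 := by
      rw [card_eq_sum_card_fiberwise (f := fun z => c z.1) (t := univ) (by simp)]
      refine sum_congr rfl fun k _ => ?_
      rw [pow_two, ← card_product]
      congr 1
      ext z
      simp only [mem_filter, memP, mem_product]
      constructor
      · rintro ⟨⟨⟨a, b⟩, h⟩, h'⟩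
        exact ⟨⟨a, h'⟩, b, h ▸ h'⟩
      · rintro ⟨⟨a, h⟩, b, h'⟩
        exact ⟨⟨⟨a, b⟩, h.trans h'.symm⟩, h⟩
    rw [hI, hP]
    exact sq_sum_le_card_mul_sum_sq
  refine h₁.trans (Nat.mul_le_mul_left _ ?_)
  have h₂ : #{z ∈ P | z.1 = z.2} ≤ #I := by
    refine card_le_card_of_injOn Prod.fst (fun z hz => ?_) fun z hz w hw h => ?_
    · simp only [coe_filter, Set.mem_ofPred_eq, memP] at hz
      exact hz.1.1.1
    · simp only [coe_filter, Set.mem_ofPred_eq] at hz hw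
      exact Prod.ext h (hz.2.symm.trans (h.trans hw.2))
  have h₃ : #{z ∈ P | ¬ z.1 = z.2} ≤
      #{z : (α × α) × (β × β) | ColorEnergyRel I c z.1 z.2} := by
    refine card_le_card_of_injOn (fun z => ((z.1.1, z.2.1), (z.1.2, z.2.2)))
      (fun z hz => ?_) fun z hz w hw h => ?_
    · simp only [coe_filter, Set.mem_ofPred_eq, memP, mem_univ, true_and] at hz ⊢
      exact ⟨hz.1.1.1, hz.1.1.2, hz.2, hz.1.2⟩
    · simp only [Prod.mk.injEq] at h
      exact Prod.ext (Prod.ext h.1.1 h.2.1) (Prod.ext h.1.2 h.2.2)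
  have h₄ := card_filter_add_card_filter_not (s := P) (fun z => z.1 = z.2)
  omega

/-- A cycle of the color energy graph of a properly colored set of edges, given by its vertices
`C` and `D` on the two sides, yields a set `F` of edges in which every color occurs at least twice
and every vertex has degree at least two. Hence the number of repetitions of colors in `F` is at
least `#F / 2`, while `#F` is at least twice the number of vertices on either side. This holds
also when the vertices of the cycle share coordinates. -/
theorem exists_card_image_add_le_of_cycle {I : Finset (α × β)} {c : α × β → κ}
    (h₁ : ∀ e ∈ I, ∀ e' ∈ I, e.1 = e'.1 → c e = c e' → e = e')
    (h₂ : ∀ e ∈ I, ∀ e' ∈ I, e.2 = e'.2 → c e = c e' → e = e')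
    {C : Finset (α × α)} {D : Finset (β × β)}
    (hC : ∀ x ∈ C, ∃ y ∈ D, ∃ y' ∈ D, y ≠ y' ∧ ColorEnergyRel I c x y ∧ ColorEnergyRel I c x y')
    (hD : ∀ y ∈ D, ∃ x ∈ C, ∃ x' ∈ C, x ≠ x' ∧ ColorEnergyRel I c x y ∧ ColorEnergyRel I c x' y)
    (hne : C.Nonempty) :
    ∃ (S : Finset α) (T : Finset β) (F : Finset (α × β)), F ⊆ I ∧ F ⊆ S ×ˢ T ∧ F.Nonempty ∧
      #S ≤ 2 * #C ∧ #T ≤ 2 * #D ∧ #(F.image c) + max #S #T ≤ #F := by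
  classical
  let F : Finset (α × β) := {e ∈ I | ∃ x ∈ C, ∃ y ∈ D, ColorEnergyRel I c x y ∧
    (e = (x.1, y.1) ∨ e = (x.2, y.2))}
  have memF : ∀ x ∈ C, ∀ y ∈ D, ColorEnergyRel I c x y → (x.1, y.1) ∈ F ∧ (x.2, y.2) ∈ F := by
    intro x hx y hy h
    exact ⟨mem_filter.2 ⟨h.1, x, hx, y, hy, h, .inl rfl⟩,
      mem_filter.2 ⟨h.2.1, x, hx, y, hy, h, .inr rfl⟩⟩
  have two : ∀ {G : Finset (α × β)} {e e' : α × β}, e ∈ G → e' ∈ G → e ≠ e' → 2 ≤ #G := by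
    intro G e e' he he' h
    rw [← card_pair h]
    exact card_le_card (by simp [insert_subset_iff, he, he'])
  let S : Finset α := C.image Prod.fst ∪ C.image Prod.snd
  let T : Finset β := D.image Prod.fst ∪ D.image Prod.snd
  have hFST : F ⊆ S ×ˢ T := by
    intro e he
    obtain ⟨-, x, hx, y, hy, -, rfl | rfl⟩ := mem_filter.1 he
    · exact mem_product.2 ⟨mem_union_left _ (mem_image_of_mem _ hx),
        mem_union_left _ (mem_image_of_mem _ hy)⟩
    · exact mem_product.2 ⟨mem_union_right _ (mem_image_of_mem _ hx),
        mem_union_right _ (mem_image_of_mem _ hy)⟩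
  have hcol : 2 * #(F.image c) ≤ #F := by
    refine mul_card_image_le_card F 2 fun k hk => ?_
    obtain ⟨e, he, rfl⟩ := mem_image.1 hk
    obtain ⟨-, x, hx, y, hy, h, hxy⟩ := mem_filter.1 he
    have hF := memF x hx y hy h
    refine two (e := (x.1, y.1)) (e' := (x.2, y.2)) ?_ ?_ h.2.2.1
    · refine mem_filter.2 ⟨hF.1, ?_⟩
      rcases hxy with rfl | rfl
      exacts [rfl, h.2.2.2]
    · refine mem_filter.2 ⟨hF.2, ?_⟩
      rcases hxy with rfl | rfl
      exacts [h.2.2.2.symm, rfl]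
  -- Properness makes the neighbors of a vertex of the color energy graph differ in both
  -- coordinates.
  have hS : 2 * #S ≤ #F := by
    refine mul_card_image_le_card_of_maps_to (f := Prod.fst)
      (fun e he => (mem_product.1 (hFST he)).1) 2 fun a ha => ?_
    rcases mem_union.1 ha with ha | ha
    all_goals
      obtain ⟨x, hx, rfl⟩ := mem_image.1 ha
      obtain ⟨y, hy, y', hy', hyy, r, r'⟩ := hC x hx
      have hF := memF x hx y hy r
      have hF' := memF x hx y' hy' r'
    · refine two (mem_filter.2 ⟨hF.1, rfl⟩) (mem_filter.2 ⟨hF'.1, rfl⟩) fun h => hyy ?_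
      have := h₁ _ r.2.1 _ r'.2.1 rfl (by rw [← r.2.2.2, ← r'.2.2.2, h])
      exact Prod.ext (Prod.ext_iff.1 h).2 (Prod.ext_iff.1 this).2
    · refine two (mem_filter.2 ⟨hF.2, rfl⟩) (mem_filter.2 ⟨hF'.2, rfl⟩) fun h => hyy ?_
      have := h₁ _ r.1 _ r'.1 rfl (by rw [r.2.2.2, r'.2.2.2, h])
      exact Prod.ext (Prod.ext_iff.1 this).2 (Prod.ext_iff.1 h).2
  have hT : 2 * #T ≤ #F := by
    refine mul_card_image_le_card_of_maps_to (f := Prod.snd)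
      (fun e he => (mem_product.1 (hFST he)).2) 2 fun a ha => ?_
    rcases mem_union.1 ha with ha | ha
    all_goals
      obtain ⟨y, hy, rfl⟩ := mem_image.1 ha
      obtain ⟨x, hx, x', hx', hxx, r, r'⟩ := hD y hy
      have hF := memF x hx y hy r
      have hF' := memF x' hx' y hy r'
    · refine two (mem_filter.2 ⟨hF.1, rfl⟩) (mem_filter.2 ⟨hF'.1, rfl⟩) fun h => hxx ?_
      have := h₂ _ r.2.1 _ r'.2.1 rfl (by rw [← r.2.2.2, ← r'.2.2.2, h])
      exact Prod.ext (Prod.ext_iff.1 h).1 (Prod.ext_iff.1 this).1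
    · refine two (mem_filter.2 ⟨hF.2, rfl⟩) (mem_filter.2 ⟨hF'.2, rfl⟩) fun h => hxx ?_
      have := h₂ _ r.1 _ r'.1 rfl (by rw [r.2.2.2, r'.2.2.2, h])
      exact Prod.ext (Prod.ext_iff.1 this).1 (Prod.ext_iff.1 h).1
  refine ⟨S, T, F, filter_subset _ _, hFST, ?_, ?_, ?_, ?_⟩
  · obtain ⟨x, hx⟩ := hne
    obtain ⟨y, hy, -, -, -, r, -⟩ := hC x hx
    exact ⟨_, (memF x hx y hy r).1⟩
  · have : #S ≤ _ := card_union_le (C.image Prod.fst) (C.image Prod.snd)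
    have := card_image_le (s := C) (f := Prod.fst)
    have := card_image_le (s := C) (f := Prod.snd)
    omega
  · have : #T ≤ _ := card_union_le (D.image Prod.fst) (D.image Prod.snd)
    have := card_image_le (s := D) (f := Prod.fst)
    have := card_image_le (s := D) (f := Prod.snd)
    omega
  · omega

/-- In a coloring in which every `p × p` rectangle has more than `p ^ 2 - p` colors, the color
energy graph has no cycle of length at most `2 * t ≤ p`, which bounds its number of edges. -/
theorem colorEnergy_le [Fintype α] [Fintype β] {c : α × β → κ}
    {p n t d : ℕ}
    (hc : ∀ (S : Finset α) (T : Finset β), #S = p → #T = p → p ^ 2 - p < #((S ×ˢ T).image c))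
    (hα : Fintype.card α = n) (hβ : Fintype.card β = n) (hn : p ≤ n) (ht : 2 * t ≤ p)
    (hd : 2 * n ^ 2 < d ^ t) {I : Finset (α × β)} (hI : ∀ e ∈ I, p ^ 2 < #{e' | c e' = c e})
    (h₁ : ∀ e ∈ I, ∀ e' ∈ I, e.1 = e'.1 → c e = c e' → e = e')
    (h₂ : ∀ e ∈ I, ∀ e' ∈ I, e.2 = e'.2 → c e = c e' → e = e') :
    #{z : (α × α) × (β × β) | ColorEnergyRel I c z.1 z.2} ≤ d * (2 * n ^ 2) := by
  by_contra! hR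
  have hcard : Fintype.card (α × α) + Fintype.card (β × β) = 2 * n ^ 2 := by
    rw [Fintype.card_prod, Fintype.card_prod, hα, hβ]
    ring
  obtain ⟨C, D, hne, hCt, hDt, hC, hD⟩ := exists_short_bipartite_cycle (ColorEnergyRel I c)
    (d := d) (t := t) (by rwa [hcard]) (by rwa [hcard])
  obtain ⟨S, T, F, hFI, hF, ⟨e₀, he₀⟩, hS, hT, hrep⟩ :=
    exists_card_image_add_le_of_cycle h₁ h₂ hC hD hne
  exact false_of_card_image_add_le hc (hα ▸ hn) (hβ ▸ hn) (by omega : max #S #T ≤ p) hF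
    (le_max_left _ _) (le_max_right _ _) hrep he₀ (hI e₀ (hFI he₀))

/-- The constant has two sources: the factor `p ^ 2` ensures that most edges have a color occurring
more than `p ^ 2` times, and `145152 = 7 * 144 ^ 2` comes from comparing the color energy, at least
`(n ^ 2 / 144) ^ 2` divided by the number of colors, with `7 * n ^ (2 / t) * n ^ 2`. -/
theorem mul_rpow_le_card_colors [Fintype α] [Fintype β] [Fintype κ] {c : α × β → κ} {p n : ℕ}
    (hc : ∀ (S : Finset α) (T : Finset β), #S = p → #T = p → p ^ 2 - p < #((S ×ˢ T).image c))
    (hp : 2 ≤ p) (hα : Fintype.card α = n) (hβ : Fintype.card β = n) (hn : p ≤ n) :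
    1 / (145152 * (p : ℝ) ^ 2) * (n : ℝ) ^ ((2 : ℝ) - 2 / ((p / 2 : ℕ) : ℝ)) ≤
      Fintype.card κ := by
  by_contra! hlt
  set t := p / 2 with ht
  set k := Fintype.card κ with hk
  have ht1 : 1 ≤ t := by omega
  have hn0 : (0 : ℝ) < n := by
    have : 0 < n := by omega
    exact_mod_cast this
  have hn1 : (1 : ℝ) ≤ n := by
    have : 1 ≤ n := by omega
    exact_mod_cast this
  have ht0 : (0 : ℝ) < t := by exact_mod_cast ht1
  set x : ℝ := (n : ℝ) ^ (2 / (t : ℝ)) with hx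
  have hx1 : 1 ≤ x := Real.one_le_rpow hn1 (by positivity)
  have hxt : x ^ t = (n : ℝ) ^ 2 := by
    rw [hx, ← Real.rpow_natCast, ← Real.rpow_mul hn0.le, div_mul_cancel₀ _ ht0.ne']
    norm_num
  have hp0 : (0 : ℝ) < p := by
    have : 0 < p := by omega
    exact_mod_cast this
  have hp4 : (4 : ℝ) ≤ (p : ℝ) ^ 2 := by
    have : (2 : ℝ) ≤ p := by exact_mod_cast hp
    nlinarith
  have hkx : 145152 * (p : ℝ) ^ 2 * (k * x) < (n : ℝ) ^ 2 := by
    rw [Real.rpow_sub hn0, ← hx] at hlt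
    have h2 : (n : ℝ) ^ (2 : ℝ) = (n : ℝ) ^ 2 := by norm_num
    rw [h2, div_mul_div_comm, one_mul, lt_div_iff₀ (by positivity)] at hlt
    linarith
  have hk0 : (0 : ℝ) ≤ k := Nat.cast_nonneg _
  have hkkx : (k : ℝ) ≤ k * x := le_mul_of_one_le_right hk0 hx1
  obtain ⟨I, hIcard, hIbig, h₁, h₂⟩ := exists_properly_colored_subset hc hp hα hβ hn (by
    have : (9 * (k * p ^ 2) : ℝ) ≤ (n : ℝ) ^ 2 := by
      have := mul_le_mul_of_nonneg_left hkkx (by positivity : 0 ≤ (p : ℝ) ^ 2)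
      nlinarith [mul_nonneg (sq_nonneg (p : ℝ)) hk0]
    exact_mod_cast this)
  -- The choice of `d` gives `2 * n ^ 2 < d ^ t` while `d ≤ 3 * n ^ (2 / t)`.
  obtain ⟨d, hd₁, hd₂⟩ : ∃ d : ℕ, 2 * x < d ∧ (d : ℝ) ≤ 3 * x := by
    refine ⟨⌊2 * x⌋₊ + 1, by exact_mod_cast Nat.lt_floor_add_one _, ?_⟩
    have := Nat.floor_le (by positivity : 0 ≤ 2 * x)
    push_cast
    linarith
  have hdt : 2 * n ^ 2 < d ^ t := by
    have h3 : (2 * x) ^ t < (d : ℝ) ^ t := pow_lt_pow_left₀ hd₁ (by positivity) (by omega)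
    have h4 : (2 : ℝ) ≤ 2 ^ t := by
      simpa using pow_le_pow_right₀ (by norm_num : (1 : ℝ) ≤ 2) ht1
    rw [mul_pow, hxt] at h3
    have h5 : (2 * n ^ 2 : ℝ) < (d : ℝ) ^ t :=
      (mul_le_mul_of_nonneg_right h4 (by positivity)).trans_lt h3
    exact_mod_cast h5
  have hR := colorEnergy_le hc hα hβ hn (by omega) hdt hIbig h₁ h₂
  have hCS := card_sq_le_card_mul_colorEnergy I c
  have hIn : #I ≤ n ^ 2 := by
    refine (card_le_univ _).trans ?_
    rw [Fintype.card_prod, hα, hβ, ← pow_two]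
  have hI2 : #I ^ 2 ≤ k * (d * (2 * n ^ 2) + n ^ 2) :=
    hCS.trans (Nat.mul_le_mul_left _ (add_le_add hR hIn))
  have hI2' : (#I : ℝ) ^ 2 ≤ k * (d * (2 * (n : ℝ) ^ 2) + (n : ℝ) ^ 2) := by exact_mod_cast hI2
  have hI1' : (n : ℝ) ^ 2 ≤ 144 * #I := by exact_mod_cast hIcard
  have e₁ : d * (2 * (n : ℝ) ^ 2) + (n : ℝ) ^ 2 ≤ 7 * x * (n : ℝ) ^ 2 := by
    nlinarith [sq_nonneg (n : ℝ)]
  have e₂ : ((n : ℝ) ^ 2) ^ 2 ≤ (144 * (#I : ℝ)) ^ 2 := pow_le_pow_left₀ (by positivity) hI1' 2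
  have e₃ : ((n : ℝ) ^ 2) ^ 2 ≤ 145152 * (k * x) * (n : ℝ) ^ 2 := by
    have := mul_le_mul_of_nonneg_left e₁ hk0
    nlinarith
  have e₄ : (n : ℝ) ^ 2 ≤ 145152 * (k * x) := by
    rw [pow_two ((n : ℝ) ^ 2)] at e₃
    exact le_of_mul_le_mul_right e₃ (by positivity)
  have : (0 : ℝ) ≤ k * x := by positivity
  nlinarith

end Repetitions

/-! ### Rectangles as copies of `K_{p,p}` -/

theorem sq_le_ncard_edgeSet_completeBipartiteGraph (p : ℕ) :
    p ^ 2 ≤ (completeBipartiteGraph (Fin p) (Fin p)).edgeSet.ncard := by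
  have h : (Set.range fun z : Fin p × Fin p =>
      (s(Sum.inl z.1, Sum.inr z.2) : Sym2 (Fin p ⊕ Fin p))).ncard = p ^ 2 := by
    rw [← Set.image_univ, Set.ncard_image_of_injective, Set.ncard_univ]
    · simp [pow_two]
    · rintro ⟨a, b⟩ ⟨a', b'⟩ h
      simpa using h
  rw [← h]
  refine Set.ncard_le_ncard ?_ (Set.toFinite _)
  rintro _ ⟨z, rfl⟩
  simp

/-- In an Erdős–Gyárfás coloring of a complete bipartite graph, viewed as a coloring of pairs,
every `p × p` rectangle has at least `q` colors. -/
theorem IsErdosGyarfasColoring.le_card_image {α β : Type*} {p q k : ℕ}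
    {c : (completeBipartiteGraph α β).edgeSet → Fin k}
    (hc : IsErdosGyarfasColoring (completeBipartiteGraph α β)
      (completeBipartiteGraph (Fin p) (Fin p)) q c)
    (S : Finset α) (T : Finset β) (hS : S.card = p) (hT : T.card = p) :
    q ≤ ((S ×ˢ T).image fun e : α × β =>
      c ⟨s(Sum.inl e.1, Sum.inr e.2), by simp⟩).card := by
  classical
  let U : Set (α ⊕ β) := Sum.inl '' (S : Set α) ∪ Sum.inr '' (T : Set β)
  let K : (completeBipartiteGraph α β).Subgraph := (⊤ : SimpleGraph.Subgraph _).induce U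
  let φ : Fin p ≃ S := (S.equivFinOfCardEq hS).symm
  let ψ : Fin p ≃ T := (T.equivFinOfCardEq hT).symm
  let f : Fin p ⊕ Fin p → K.verts := Sum.elim
    (fun i => ⟨.inl (φ i), Or.inl ⟨_, (φ i).2, rfl⟩⟩)
    (fun i => ⟨.inr (ψ i), Or.inr ⟨_, (ψ i).2, rfl⟩⟩)
  have hf : Function.Bijective f := by
    constructor
    · rintro (i | i) (j | j) h <;> simp_all [f, Subtype.ext_iff]
    · rintro ⟨_, ⟨a, ha, rfl⟩ | ⟨b, hb, rfl⟩⟩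
      · exact ⟨.inl (φ.symm ⟨a, ha⟩), by simp [f]⟩
      · exact ⟨.inr (ψ.symm ⟨b, hb⟩), by simp [f]⟩
  have hiso : Nonempty (completeBipartiteGraph (Fin p) (Fin p) ≃g K.coe) := by
    refine ⟨⟨Equiv.ofBijective f hf, ?_⟩⟩
    rintro (i | i) (j | j) <;> simp [f, K, U]
  refine (hc K hiso).trans ?_
  rw [← Set.ncard_coe_finset]
  refine Set.ncard_le_ncard ?_ (Finset.finite_toSet _)
  rintro _ ⟨⟨e, he⟩, hK, rfl⟩
  rw [Finset.coe_image]
  induction e using Sym2.ind with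
  | _ u v =>
    have hK' : K.Adj u v := hK
    simp only [K, U, SimpleGraph.Subgraph.induce_adj] at hK'
    obtain ⟨hu, hv, had⟩ := hK'
    rcases u with a | a <;> rcases v with b | b
    · simp at had
    · exact ⟨(a, b), by simpa using And.intro hu hv, rfl⟩
    · refine ⟨(b, a), by simpa using And.intro hv hu, ?_⟩
      exact congrArg c (Subtype.ext
        (Sym2.eq_swap : s(Sum.inl b, Sum.inr a) = s(Sum.inr a, Sum.inl b)))
    · simp at had

/-- For every `p ≥ 2`, `r(K_{n,n}, K_{p,p}, p² - p + 1) = Ω(n^{2 - 2/⌊p/2⌋})` as `n → ∞`, the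
implied positive constant depending only on `p`. -/
theorem mainTheorem1 (p : ℕ) (hp : 2 ≤ p) :
    ∃ C : ℝ, 0 < C ∧ ∃ N : ℕ, ∀ n : ℕ, N ≤ n →
      C * (n : ℝ) ^ ((2 : ℝ) - 2 / ((p / 2 : ℕ) : ℝ)) ≤
        (erdosGyarfasNumber (completeBipartiteGraph (Fin n) (Fin n))
          (completeBipartiteGraph (Fin p) (Fin p)) (p ^ 2 - p + 1) : ℝ) := by
  refine ⟨1 / (145152 * (p : ℝ) ^ 2), by positivity, p, fun n hn => ?_⟩
  obtain ⟨c, hc⟩ := exists_isErdosGyarfasColoring (completeBipartiteGraph (Fin n) (Fin n))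
    (completeBipartiteGraph (Fin p) (Fin p)) (p ^ 2 - p + 1) (by
      have h₁ := sq_le_ncard_edgeSet_completeBipartiteGraph p
      have h₂ : p ≤ p ^ 2 := Nat.le_self_pow two_ne_zero p
      omega)
  have h := mul_rpow_le_card_colors (n := n) (fun S T hS hT => hc.le_card_image S T hS hT) hp
    (Fintype.card_fin n) (Fintype.card_fin n) hn
  rwa [Fintype.card_fin] at h
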